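/- Let $D\subset\mathbb C^n$ be a bounded convex domain (a nonempty bounded convex open set) and let $z_0\in\partial D$. Let $L(z_0)$ be the set of all $X\in\mathbb C^n$ for which there is $\varepsilon>0$ such that $z_0+\lambda X\in\partial D$ for all $\lambda\in\mathbb C$ with $|\lambda|\le\varepsilon$. By an analytic curve we mean the image $\varphi(U)$ of a holomorphic map $\varphi:U\to\mathbb C^n$ defined on a nonempty connected open set $U\subset\mathbb C$; constant maps are allowed, so that single points are (trivial) analytic curves. Then the following conditions are equivalent: 1. $z_0$ is a (holomorphic) peak point of $D$, that is, there is a function $f$, holomorphic on $D$ and continuous on $\overline D$, such that $f(z_0)=1$ and $|f(z)|<1$ for all $z\in\overline D\setminus\{z_0\}$; 2. $\{z_0\}$ is the only analytic curve that is contained in $\overline D$ and contains $z_0$; 3. $L(z_0)=\{0\}$. -/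

import Mathlib

/-- `z₀` is a (holomorphic) peak point of `D`: there is a function of the algebra `A⁰(D)`
(holomorphic on `D`, continuous on `closure D`) which takes the value `1` at `z₀` and has
modulus less than `1` at every other point of `closure D`. -/
def IsHolomorphicPeakPoint {E : Type*} [NormedAddCommGroup E] [NormedSpace ℂ E]
    (D : Set E) (z₀ : E) : Prop :=
  ∃ f : E → ℂ, DifferentiableOn ℂ f D ∧ ContinuousOn f (closure D) ∧
    f z₀ = 1 ∧ ∀ z ∈ closure D, z ≠ z₀ → ‖f z‖ < 1

/-- An analytic curve is the image of a (nonempty) domain of `ℂ` under a holomorphic map.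
The constant maps are allowed: single points are the trivial analytic curves. -/
def IsAnalyticCurve {E : Type*} [NormedAddCommGroup E] [NormedSpace ℂ E]
    (C : Set E) : Prop :=
  ∃ (U : Set ℂ) (φ : ℂ → E), IsOpen U ∧ IsConnected U ∧ DifferentiableOn ℂ φ U ∧ C = φ '' U

/-- `L(z₀)`: the set of all `X` such that, for some `ε > 0`, the point `z₀ + λ X` lies on the
boundary of `D` for all complex numbers `λ` with `|λ| ≤ ε`. -/
def boundaryDirections {E : Type*} [NormedAddCommGroup E] [NormedSpace ℂ E]
    (D : Set E) (z₀ : E) : Set E :=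
  {X | ∃ ε : ℝ, 0 < ε ∧ ∀ c : ℂ, ‖c‖ ≤ ε → z₀ + c • X ∈ frontier D}

open Set Filter Topology

/-! The substantial direction is from trivial `boundaryDirections` to a peak point. A supporting
functional gives a function peaking on the section of `closure D` by a complex hyperplane through
`z₀`. Let `V` be the direction of a section that is a peak set. If `0` is interior in `V` to the
translated section, small discs at `z₀` in every direction of `V` lie in the boundary, so `V = ⊥`.
Otherwise a supporting functional inside `V` cuts out a smaller section; the new function `g` is
controlled only on the old one, and `IsHolomorphicPeakSet.inter` repairs this by multiplying it by
an average of powers of the old peak function. Finite dimension ends the descent. Conversely, the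
maximum principle, applied to a peak function along a curve, makes the curve constant, and boundary
discs are themselves analytic curves. -/

/-- `S` is, within `closure D`, the peak set of a function of the algebra `A⁰(D)` which does not
attain its maximum modulus in `D`. -/
def IsHolomorphicPeakSet {E : Type*} [NormedAddCommGroup E] [NormedSpace ℂ E]
    (D S : Set E) : Prop :=
  ∃ f : E → ℂ, DifferentiableOn ℂ f D ∧ ContinuousOn f (closure D) ∧ (∀ z ∈ D, ‖f z‖ < 1) ∧
    (∀ z ∈ closure D, z ∈ S → f z = 1) ∧ ∀ z ∈ closure D, z ∉ S → ‖f z‖ < 1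

/-! ### Averages of powers and Bishop's combination -/

theorem hasSum_half_pow_succ : HasSum (fun n : ℕ => (1 / 2 : ℝ) ^ (n + 1)) 1 := by
  have := (hasSum_geometric_two).mul_left (1 / 2 : ℝ)
  simpa [pow_succ, mul_comm] using this

/-- The lacunary average `∑ 2⁻ⁿ⁻¹ w ^ kₙ`. -/
noncomputable def powAverage (k : ℕ → ℕ) (w : ℂ) : ℂ :=
  ∑' n : ℕ, (1 / 2 : ℂ) ^ (n + 1) * w ^ k n

theorem norm_powAverage_term_le (k : ℕ → ℕ) (n : ℕ) {w : ℂ} (hw : ‖w‖ ≤ 1) :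
    ‖(1 / 2 : ℂ) ^ (n + 1) * w ^ k n‖ ≤ (1 / 2 : ℝ) ^ (n + 1) := by
  have : ‖w‖ ^ k n ≤ 1 := pow_le_one₀ (norm_nonneg _) hw
  rw [norm_mul, norm_pow, norm_pow]
  have h2 : ‖(1 / 2 : ℂ)‖ = 1 / 2 := by norm_num
  rw [h2]
  exact mul_le_of_le_one_right (by positivity) this

theorem continuousOn_powAverage (k : ℕ → ℕ) :
    ContinuousOn (powAverage k) (Metric.closedBall 0 1) := by
  refine continuousOn_tsum (fun n => by fun_prop) hasSum_half_pow_succ.summable ?_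
  intro n w hw
  exact norm_powAverage_term_le k n (by simpa using hw)

theorem differentiableOn_powAverage (k : ℕ → ℕ) :
    DifferentiableOn ℂ (powAverage k) (Metric.ball 0 1) := by
  refine Complex.differentiableOn_tsum_of_summable_norm hasSum_half_pow_succ.summable
    (fun n => by fun_prop) Metric.isOpen_ball ?_
  intro n w hw
  exact norm_powAverage_term_le k n (by simpa using (Metric.ball_subset_closedBall hw))

theorem powAverage_one (k : ℕ → ℕ) : powAverage k 1 = 1 := by
  have h := hasSum_half_pow_succ
  have : HasSum (fun n : ℕ => (1 / 2 : ℂ) ^ (n + 1) * 1 ^ k n) 1 := by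
    have := Complex.hasSum_ofReal.2 h
    simpa using this
  exact this.tsum_eq

theorem norm_powAverage_le (k : ℕ → ℕ) {w : ℂ} (hw : ‖w‖ ≤ 1) :
    ‖powAverage k w‖ ≤ ∑' n : ℕ, (1 / 2 : ℝ) ^ (n + 1) * ‖w‖ ^ k n := by
  have hs : Summable (fun n => ‖(1 / 2 : ℂ) ^ (n + 1) * w ^ k n‖) :=
    Summable.of_nonneg_of_le (fun _ => norm_nonneg _)
      (fun n => norm_powAverage_term_le k n hw) hasSum_half_pow_succ.summable
  refine (norm_tsum_le_tsum_norm hs).trans (le_of_eq ?_)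
  refine tsum_congr fun n => ?_
  rw [norm_mul, norm_pow, norm_pow]
  norm_num

theorem norm_powAverage_lt_one {k : ℕ → ℕ} (hk : ∀ n, k n ≠ 0) {w : ℂ} (hw : ‖w‖ < 1) :
    ‖powAverage k w‖ < 1 := by
  have hle : ∀ n, (1 / 2 : ℝ) ^ (n + 1) * ‖w‖ ^ k n ≤ (1 / 2 : ℝ) ^ (n + 1) * ‖w‖ := fun n =>
    mul_le_mul_of_nonneg_left (pow_le_of_le_one (norm_nonneg _) hw.le (hk n)) (by positivity)
  have hs := hasSum_half_pow_succ.mul_right ‖w‖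
  have h2 := Summable.of_nonneg_of_le (fun n => by positivity) hle hs.summable
  calc ‖powAverage k w‖ ≤ _ := norm_powAverage_le k hw.le
    _ ≤ _ := h2.tsum_le_tsum hle hs.summable
    _ = 1 * ‖w‖ := hs.tsum_eq
    _ < 1 := by simpa

/-- The estimate behind Bishop's combination of peak functions: if `b ‖w‖ ^ kₙ` is small as soon
as `b` exceeds `1` by `2⁻ⁿ / 8`, then the average `∑ 2⁻ⁿ⁻¹ w ^ kₙ` has modulus less than `1 / b`. -/
theorem mul_norm_powAverage_lt_one {k : ℕ → ℕ} {w : ℂ} (hw : ‖w‖ < 1)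
    {b : ℝ} (hb : 1 < b) (hkb : ∀ n : ℕ, 1 + (1 / 2 : ℝ) ^ n / 8 ≤ b → b * ‖w‖ ^ k n ≤ 1 / 2) :
    b * ‖powAverage k w‖ < 1 := by
  classical
  have hb0 : 0 < b := by linarith
  have hex : ∃ n : ℕ, 1 + (1 / 2 : ℝ) ^ n / 8 ≤ b := by
    obtain ⟨n, hn⟩ := exists_pow_lt_of_lt_one (sub_pos.2 hb) (by norm_num : (1 / 2 : ℝ) < 1)
    have : (0 : ℝ) < (1 / 2) ^ n := by positivity
    exact ⟨n, by linarith⟩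
  -- `N` is the first threshold reached by `b`. With `q = 2⁻ᴺ`, terms before `N` contribute at most
  -- `(1 - q)(1 + q/4)` and the others at most `q/2`; the total is `1 - q/4 - q²/4`.
  obtain ⟨N, hN, hmin⟩ : ∃ N : ℕ, 1 + (1 / 2 : ℝ) ^ N / 8 ≤ b ∧
      ∀ m < N, b < 1 + (1 / 2 : ℝ) ^ m / 8 :=
    ⟨Nat.find hex, Nat.find_spec hex, fun m hm => not_le.1 (Nat.find_min hex hm)⟩
  set u : ℕ → ℝ := fun n => (1 / 2 : ℝ) ^ (n + 1) * (b * ‖w‖ ^ k n) with hu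
  have hsum : Summable u := by
    refine Summable.of_nonneg_of_le (fun n => by positivity) (fun n => ?_)
      (hasSum_half_pow_succ.mul_right b).summable
    exact mul_le_mul_of_nonneg_left (mul_le_of_le_one_right hb0.le
      (pow_le_one₀ (norm_nonneg _) hw.le)) (by positivity)
  have hq : (0 : ℝ) < (1 / 2) ^ N := by positivity
  have hq1 : (1 / 2 : ℝ) ^ N ≤ 1 := pow_le_one₀ (by norm_num) (by norm_num)
  have htail : HasSum (fun n : ℕ => (1 / 2 : ℝ) ^ (n + N + 1)) ((1 / 2) ^ N) := by
    have := hasSum_half_pow_succ.mul_left ((1 / 2 : ℝ) ^ N)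
    simpa [pow_add, mul_comm, mul_left_comm, mul_assoc] using this
  have hhead : ∑ n ∈ Finset.range N, (1 / 2 : ℝ) ^ (n + 1) = 1 - (1 / 2) ^ N := by
    have h1 := hasSum_half_pow_succ.summable.sum_add_tsum_nat_add N
    rw [hasSum_half_pow_succ.tsum_eq, htail.tsum_eq] at h1
    linarith
  have h1 : ∑ n ∈ Finset.range N, u n ≤ (1 - (1 / 2) ^ N) * (1 + (1 / 2) ^ N / 4) := by
    rw [← hhead, Finset.sum_mul]
    refine Finset.sum_le_sum fun n hn => mul_le_mul_of_nonneg_left ?_ (by positivity)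
    have hN0 : N - 1 < N := by have := Finset.mem_range.1 hn; omega
    have hN1 : (1 / 2 : ℝ) ^ (N - 1) = 2 * (1 / 2) ^ N := by
      obtain ⟨M, rfl⟩ : ∃ M, N = M + 1 := ⟨N - 1, by omega⟩
      rw [Nat.add_sub_cancel, pow_succ]; ring
    have := hmin _ hN0
    rw [hN1] at this
    calc b * ‖w‖ ^ k n ≤ b := mul_le_of_le_one_right hb0.le (pow_le_one₀ (norm_nonneg _) hw.le)
      _ ≤ _ := by linarith
  have h2 : ∑' n, u (n + N) ≤ (1 / 2) ^ N * (1 / 2) := by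
    rw [← (htail.mul_right (1 / 2)).tsum_eq]
    refine ((summable_nat_add_iff N).2 hsum).tsum_le_tsum (fun n => ?_)
      (htail.mul_right (1 / 2)).summable
    refine mul_le_mul_of_nonneg_left (hkb _ (le_trans ?_ hN)) (by positivity)
    have : (1 / 2 : ℝ) ^ (n + N) ≤ (1 / 2) ^ N :=
      pow_le_pow_of_le_one (by norm_num) (by norm_num) (by omega)
    linarith
  calc b * ‖powAverage k w‖ ≤ b * ∑' n : ℕ, (1 / 2 : ℝ) ^ (n + 1) * ‖w‖ ^ k n :=
        mul_le_mul_of_nonneg_left (norm_powAverage_le k hw.le) hb0.le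
    _ = ∑' n, u n := by
        rw [← tsum_mul_left]; exact tsum_congr fun n => by simp only [hu]; ring
    _ = _ := (hsum.sum_add_tsum_nat_add N).symm
    _ < 1 := by nlinarith

/-- A peak set, relative to a peak set of `A⁰(D)`, of a function of `A⁰(D)` is a peak set. -/
theorem IsHolomorphicPeakSet.inter {E : Type*} [NormedAddCommGroup E] [NormedSpace ℂ E]
    {D S T : Set E} (hD : IsCompact (closure D)) (hS : IsHolomorphicPeakSet D S)
    {g : E → ℂ} (hgd : DifferentiableOn ℂ g D) (hgc : ContinuousOn g (closure D))
    (hg1 : ∀ z ∈ closure D, z ∈ S → z ∈ T → g z = 1)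
    (hg2 : ∀ z ∈ closure D, z ∈ S → z ∉ T → ‖g z‖ < 1) :
    IsHolomorphicPeakSet D (S ∩ T) := by
  obtain ⟨f, hfd, hfc, hfD, hf1, hf2⟩ := hS
  have hfle : ∀ z ∈ closure D, ‖f z‖ ≤ 1 := fun z hz => by
    by_cases h : z ∈ S
    · simp [hf1 z hz h]
    · exact (hf2 z hz h).le
  have hgS : ∀ z ∈ closure D, z ∈ S → ‖g z‖ ≤ 1 := fun z hz h => by
    by_cases h' : z ∈ T
    · simp [hg1 z hz h h']
    · exact (hg2 z hz h h').le
  -- Where `‖g‖` exceeds `1` by a fixed amount, a compact set disjoint from `S`, `‖f‖` is bounded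
  -- away from `1`, so a high power of `f` absorbs `g`.
  have hk : ∀ n : ℕ, ∃ k : ℕ, k ≠ 0 ∧
      ∀ z ∈ closure D, 1 + (1 / 2 : ℝ) ^ n / 8 ≤ ‖g z‖ → ‖g z‖ * ‖f z‖ ^ k ≤ 1 / 2 := by
    intro n
    obtain ⟨M, hM⟩ := hD.exists_bound_of_continuousOn hgc
    have hcpt : IsCompact (closure D ∩ (fun z => ‖g z‖) ⁻¹' Ici (1 + (1 / 2 : ℝ) ^ n / 8)) :=
      hD.of_isClosed_subset (hgc.norm.preimage_isClosed_of_isClosed isClosed_closure isClosed_Ici)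
        inter_subset_left
    rcases eq_empty_or_nonempty
      (closure D ∩ (fun z => ‖g z‖) ⁻¹' Ici (1 + (1 / 2 : ℝ) ^ n / 8)) with he | hne
    · refine ⟨1, one_ne_zero, fun z hz h => ?_⟩
      exact absurd ⟨hz, h⟩ (eq_empty_iff_forall_notMem.1 he z)
    obtain ⟨x, hx, hmax⟩ := hcpt.exists_isMaxOn hne (hfc.norm.mono inter_subset_left)
    have hx1 : ‖f x‖ < 1 := by
      refine hf2 x hx.1 fun hxS => ?_
      have h1 := hgS x hx.1 hxS
      have h2 : 1 + (1 / 2 : ℝ) ^ n / 8 ≤ ‖g x‖ := hx.2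
      have : (0 : ℝ) < (1 / 2) ^ n := by positivity
      linarith
    have hM1 : 0 < |M| + 1 := by positivity
    obtain ⟨m, hm⟩ := exists_pow_lt_of_lt_one (show 0 < 1 / 2 / (|M| + 1) by positivity) hx1
    refine ⟨m + 1, m.succ_ne_zero, fun z hz h => ?_⟩
    have h1 : ‖f z‖ ^ (m + 1) ≤ 1 / 2 / (|M| + 1) :=
      calc ‖f z‖ ^ (m + 1) ≤ ‖f x‖ ^ (m + 1) := pow_le_pow_left₀ (norm_nonneg _) (hmax ⟨hz, h⟩) _
        _ ≤ ‖f x‖ ^ m := pow_le_pow_of_le_one (norm_nonneg _) hx1.le (by omega)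
        _ ≤ _ := hm.le
    calc ‖g z‖ * ‖f z‖ ^ (m + 1) ≤ (|M| + 1) * (1 / 2 / (|M| + 1)) := by
          refine mul_le_mul ?_ h1 (by positivity) hM1.le
          linarith [hM z hz, le_abs_self M]
      _ = 1 / 2 := by field_simp
  choose k hk0 hk using hk
  have hlt : ∀ z ∈ closure D, ‖f z‖ < 1 → ‖g z * powAverage k (f z)‖ < 1 := by
    intro z hz hfz
    rw [norm_mul]
    rcases le_or_gt ‖g z‖ 1 with h | h
    · exact (mul_le_of_le_one_left (norm_nonneg _) h).trans_lt (norm_powAverage_lt_one hk0 hfz)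
    · exact mul_norm_powAverage_lt_one hfz h fun n hn => hk n z hz hn
  refine ⟨fun z => g z * powAverage k (f z), ?_, ?_, ?_, ?_, ?_⟩
  · exact hgd.mul ((differentiableOn_powAverage k).comp hfd fun z hz => by simpa using hfD z hz)
  · exact hgc.mul ((continuousOn_powAverage k).comp hfc fun z hz => by simpa using hfle z hz)
  · exact fun z hz => hlt z (subset_closure hz) (hfD z hz)
  · rintro z hz ⟨h1, h2⟩
    simp [hf1 z hz h1, hg1 z hz h1 h2, powAverage_one]
  · intro z hz h
    by_cases hS : z ∈ S
    · simpa [hf1 z hz hS, powAverage_one] using hg2 z hz hS fun hT => h ⟨hS, hT⟩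
    · exact hlt z hz (hf2 z hz hS)

/-! ### Supporting functionals and peaking functions -/

/-- A point which is not interior to a convex set of a finite-dimensional space admits a
supporting functional. -/
theorem Convex.exists_dual_ne_zero_le_of_notMem_interior {V : Type*} [NormedAddCommGroup V]
    [NormedSpace ℝ V] [FiniteDimensional ℝ V] {K : Set V} (hK : Convex ℝ K) {x : V} (hx : x ∈ K)
    (h : x ∉ interior K) : ∃ f : StrongDual ℝ V, f ≠ 0 ∧ ∀ y ∈ K, f y ≤ f x := by
  by_cases hne : (interior K).Nonempty
  · obtain ⟨f, hf⟩ := geometric_hahn_banach_open_point hK.interior isOpen_interior h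
    refine ⟨f, ?_, fun y hy => ?_⟩
    · rintro rfl
      obtain ⟨a, ha⟩ := hne
      simpa using hf a ha
    · have hy' : y ∈ closure (interior K) := by
        rw [hK.closure_interior_eq_closure_of_nonempty_interior hne]
        exact subset_closure hy
      exact closure_minimal (fun a ha => (hf a ha).le) (isClosed_le f.continuous continuous_const) hy'
  -- With empty interior, `K` lies in a proper affine subspace, on which some nonzero functional is
  -- constant.
  · rw [hK.interior_nonempty_iff_affineSpan_eq_top] at hne
    have hdir : vectorSpan ℝ K < ⊤ := by
      rw [lt_top_iff_ne_top]
      intro ht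
      exact hne ((AffineSubspace.affineSpan_eq_top_iff_vectorSpan_eq_top_of_nonempty
        ℝ V V ⟨x, hx⟩).2 ht)
    obtain ⟨f, hf0, hf⟩ := Submodule.exists_le_ker_of_lt_top _ hdir
    refine ⟨LinearMap.toContinuousLinearMap f, ?_, fun y hy => ?_⟩
    · simpa using hf0
    · have : f (y - x) = 0 := hf (vsub_mem_vectorSpan ℝ hy hx)
      rw [map_sub, sub_eq_zero] at this
      simp [this]

/-- The entire function `exp (w + ε w²)` peaks at `0` on the bounded parts of the closed left
half-plane. -/
theorem norm_exp_add_sq_lt_one {R : ℝ} (hR : 0 < R) {w : ℂ} (hw : ‖w‖ < R) (hre : w.re ≤ 0)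
    (h0 : w ≠ 0) : ‖Complex.exp (w + ((1 / R : ℝ) : ℂ) * w ^ 2)‖ < 1 := by
  rw [Complex.norm_exp, Real.exp_lt_one_iff]
  have hx : -R < w.re := by
    have := (abs_le.1 (Complex.abs_re_le_norm w)).1
    linarith
  -- The square supplies `-(im w)²`, giving decay on the imaginary axis; the factor `1 / R` is small
  -- enough to keep the real part negative inside the half-plane.
  have heq : (w + ((1 / R : ℝ) : ℂ) * w ^ 2).re = (w.re * (R + w.re) - w.im ^ 2) / R := by
    rw [Complex.add_re, Complex.re_ofReal_mul, sq w, Complex.mul_re]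
    field_simp
    ring
  rw [heq]
  refine div_neg_of_neg_of_pos ?_ hR
  rcases hre.lt_or_eq with h | h
  · nlinarith [mul_pos (neg_pos.2 h) (show 0 < R + w.re by linarith), sq_nonneg w.im]
  · have : w.im ≠ 0 := fun hi => h0 (Complex.ext h hi)
    have := sq_pos_of_ne_zero this
    rw [h]; linarith

section

variable {E : Type*} [NormedAddCommGroup E] [NormedSpace ℂ E]

theorem exists_peaking_of_re_nonpos {D : Set E} (hD : Bornology.IsBounded D) (z₀ : E)
    (ℓ : E →L[ℂ] ℂ) : ∃ g : E → ℂ, Differentiable ℂ g ∧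
      (∀ z, ℓ (z - z₀) = 0 → g z = 1) ∧
      ∀ z ∈ closure D, (ℓ (z - z₀)).re ≤ 0 → ℓ (z - z₀) ≠ 0 → ‖g z‖ < 1 := by
  obtain ⟨R, hR, hb⟩ : ∃ R : ℝ, 0 < R ∧ ∀ z ∈ closure D, ‖ℓ (z - z₀)‖ < R := by
    obtain ⟨r, hr⟩ := hD.closure.subset_closedBall z₀
    refine ⟨‖ℓ‖ * |r| + 1, by positivity, fun z hz => ?_⟩
    have h1 : ‖z - z₀‖ ≤ |r| := by
      have := hr hz
      rw [Metric.mem_closedBall, dist_eq_norm] at this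
      exact this.trans (le_abs_self r)
    have := (ℓ.le_opNorm (z - z₀)).trans (mul_le_mul_of_nonneg_left h1 (norm_nonneg ℓ))
    linarith
  refine ⟨fun z => Complex.exp (ℓ (z - z₀) + ((1 / R : ℝ) : ℂ) * ℓ (z - z₀) ^ 2), by fun_prop, ?_, ?_⟩
  · intro z hz
    simp [hz]
  · exact fun z hz hre h0 => norm_exp_add_sq_lt_one hR (hb z hz) hre h0

/-- If a segment through the boundary point `z₀` of a convex open set is centred at `z₀` and
contained in the closure, then its endpoint is a boundary point. -/
theorem Convex.mem_frontier_of_add_of_sub {D : Set E} (ho : IsOpen D) (hc : Convex ℝ D)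
    {z₀ v : E} (hz₀ : z₀ ∈ frontier D) (h1 : z₀ + v ∈ closure D) (h2 : z₀ - v ∈ closure D) :
    z₀ + v ∈ frontier D := by
  rw [ho.frontier_eq] at hz₀ ⊢
  refine ⟨h1, fun hv => hz₀.2 ?_⟩
  have := hc.combo_interior_closure_mem_interior (ho.interior_eq.symm ▸ hv) h2
    (a := 1 / 2) (b := 1 / 2) (by norm_num) (by norm_num) (by norm_num)
  rw [ho.interior_eq] at this
  convert this using 1
  rw [smul_add, smul_sub, add_add_sub_cancel, ← add_smul]
  norm_num

/-- A real supporting functional on `V` is the real part of a complex one, which extends to `E`.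
Being nonzero on `V`, it makes the intersection with its kernel strictly smaller, as the descent
requires. -/
theorem exists_functional_of_notMem_interior [FiniteDimensional ℂ E] (V : Submodule ℂ E)
    {K : Set V} (hK : Convex ℝ K) (h0 : (0 : V) ∈ K) (hint : (0 : V) ∉ interior K) :
    ∃ ℓ : E →L[ℂ] ℂ, (∀ v ∈ K, (ℓ v).re ≤ 0) ∧ V ⊓ LinearMap.ker (ℓ : E →ₗ[ℂ] ℂ) < V := by
  have : FiniteDimensional ℝ V := FiniteDimensional.complexToReal V
  obtain ⟨f, hf0, hf⟩ := hK.exists_dual_ne_zero_le_of_notMem_interior h0 hint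
  obtain ⟨L, hL⟩ := LinearMap.exists_extend
    ((StrongDual.extendRCLike (𝕜 := ℂ) f : StrongDual ℂ V) : V →ₗ[ℂ] ℂ)
  have hLv : ∀ v : V, L v = StrongDual.extendRCLike (𝕜 := ℂ) f v := fun v => LinearMap.congr_fun hL v
  have hre : ∀ v : V, (L v).re = f v := fun v => by
    rw [hLv]; exact StrongDual.re_extendRCLike_apply (𝕜 := ℂ) f v
  refine ⟨LinearMap.toContinuousLinearMap L, fun v hv => ?_, lt_of_le_of_ne inf_le_left ?_⟩
  · have := hf v hv
    rw [map_zero] at this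
    simpa [hre] using this
  · intro h
    apply hf0
    ext v
    have hv : (v : E) ∈ LinearMap.ker L := by
      have : (v : E) ∈ V ⊓ LinearMap.ker L := by
        have h' : V ⊓ LinearMap.ker L = V := by simpa using h
        rw [h']; exact v.2
      exact this.2
    rw [← hre, LinearMap.mem_ker.1 hv]
    simp

/-! ### Descent to the boundary point -/

/-- The sections of `closure D` by complex affine subspaces which are peak sets can be cut down to
the boundary point `z₀`, provided that no complex disc centred at `z₀` lies in the boundary. -/
theorem isHolomorphicPeakPoint_of_isHolomorphicPeakSet [FiniteDimensional ℂ E] {D : Set E}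
    (ho : IsOpen D) (hc : Convex ℝ D) (hb : Bornology.IsBounded D) {z₀ : E}
    (hz₀ : z₀ ∈ frontier D) (hL : boundaryDirections D z₀ = {0}) (V : Submodule ℂ E)
    (hV : IsHolomorphicPeakSet D {z | z - z₀ ∈ V}) : IsHolomorphicPeakPoint D z₀ := by
  have : ProperSpace E := FiniteDimensional.proper ℂ E
  have hz : z₀ ∈ closure D := frontier_subset_closure hz₀
  induction V using WellFoundedLT.induction with
  | ind V ih =>
    set K : Set V := {v | z₀ + (v : E) ∈ closure D} with hKdef
    have hK : Convex ℝ K := by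
      intro x hx y hy a b ha hb hab
      have := hc.closure hx hy ha hb hab
      change z₀ + ((a • x + b • y : V) : E) ∈ closure D
      convert this using 1
      simp only [Submodule.coe_add, Submodule.coe_smul_of_tower, smul_add]
      rw [add_add_add_comm, ← add_smul, hab, one_smul]
    have h0 : (0 : V) ∈ K := by simpa [hKdef] using hz
    by_cases hint : (0 : V) ∈ interior K
    · have hbot : V = ⊥ := by
        rw [Submodule.eq_bot_iff]
        intro X hX
        have : X ∈ boundaryDirections D z₀ := by
          have hcont : Tendsto (fun c : ℂ => c • (⟨X, hX⟩ : V)) (𝓝 0) (𝓝 0) := by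
            have : Continuous (fun c : ℂ => c • (⟨X, hX⟩ : V)) := by fun_prop
            simpa using this.tendsto 0
          obtain ⟨ε, hε, hball⟩ := Metric.nhds_basis_closedBall.mem_iff.1
            (hcont (mem_interior_iff_mem_nhds.1 hint))
          refine ⟨ε, hε, fun c hcε => ?_⟩
          have hmem : ∀ d : ℂ, ‖d‖ ≤ ε → z₀ + d • X ∈ closure D := fun d hd =>
            hball (show d ∈ Metric.closedBall (0 : ℂ) ε by simpa using hd)
          refine hc.mem_frontier_of_add_of_sub ho hz₀ (hmem c hcε) ?_
          simpa [sub_eq_add_neg] using hmem (-c) (by simpa using hcε)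
        rw [hL] at this
        exact this
      subst hbot
      obtain ⟨f, hfd, hfc, -, hf1, hf2⟩ := hV
      refine ⟨f, hfd, hfc, hf1 z₀ hz (by simp), fun z hzD hne => hf2 z hzD ?_⟩
      simpa [sub_eq_zero] using hne
    · obtain ⟨ℓ, hℓ, hlt⟩ := exists_functional_of_notMem_interior V hK h0 hint
      obtain ⟨g, hg, hg1, hg2⟩ := exists_peaking_of_re_nonpos hb z₀ ℓ
      refine ih _ hlt ?_
      refine hV.inter (T := {z | ℓ (z - z₀) = 0}) hb.isCompact_closure hg.differentiableOn
        hg.continuous.continuousOn (fun z _ _ hT => hg1 z hT) fun z hzD hS hT => ?_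
      refine hg2 z hzD (hℓ ⟨z - z₀, hS⟩ ?_) hT
      simpa [hKdef] using hzD

theorem isHolomorphicPeakPoint_of_boundaryDirections [FiniteDimensional ℂ E] {D : Set E}
    (ho : IsOpen D) (hc : Convex ℝ D) (hb : Bornology.IsBounded D) {z₀ : E}
    (hz₀ : z₀ ∈ frontier D) (hL : boundaryDirections D z₀ = {0}) :
    IsHolomorphicPeakPoint D z₀ := by
  have hnot : z₀ ∉ D := by rw [ho.frontier_eq] at hz₀; exact hz₀.2
  obtain ⟨ℓ, hℓ⟩ := RCLike.geometric_hahn_banach_open_point (𝕜 := ℂ) hc ho hnot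
  obtain ⟨g, hg, hg1, hg2⟩ := exists_peaking_of_re_nonpos hb z₀ ℓ
  -- Strictness on `D` makes the first peak function map `D` into the open disc, where `powAverage`
  -- is holomorphic.
  have hlt : ∀ z ∈ D, (ℓ (z - z₀)).re < 0 := fun z hz => by
    rw [map_sub, Complex.sub_re, sub_neg]; exact hℓ z hz
  have hle : ∀ z ∈ closure D, (ℓ (z - z₀)).re ≤ 0 :=
    closure_minimal (fun z hz => (hlt z hz).le)
      (isClosed_le (f := fun z => (ℓ (z - z₀)).re)
        (Complex.continuous_re.comp (ℓ.continuous.comp (continuous_id.sub continuous_const)))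
        continuous_const)
  refine isHolomorphicPeakPoint_of_isHolomorphicPeakSet ho hc hb hz₀ hL
    (LinearMap.ker (ℓ : E →ₗ[ℂ] ℂ)) ⟨g, hg.differentiableOn, hg.continuous.continuousOn,
      fun z hz => ?_, fun z _ hS => hg1 z hS, fun z hz hS => hg2 z hz (hle z hz) hS⟩
  refine hg2 z (subset_closure hz) (hlt z hz).le fun h => ?_
  simpa [h] using hlt z hz

/-! ### Analytic curves and the maximum principle -/

/-- A function of `A⁰(D)`, for `D` bounded convex, is holomorphic along holomorphic curves in
`closure D`. -/
theorem Convex.differentiableOn_comp_of_mapsTo_closure [ProperSpace E] {D : Set E} (ho : IsOpen D)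
    (hc : Convex ℝ D) (hb : Bornology.IsBounded D) {f : E → ℂ} (hfd : DifferentiableOn ℂ f D)
    (hfc : ContinuousOn f (closure D)) {U : Set ℂ} (hU : IsOpen U) {φ : ℂ → E}
    (hφ : DifferentiableOn ℂ φ U) (hmaps : MapsTo φ U (closure D)) :
    DifferentiableOn ℂ (f ∘ φ) U := by
  rcases D.eq_empty_or_nonempty with rfl | ⟨p, hp⟩
  · have : U = ∅ := by
      rw [eq_empty_iff_forall_notMem]
      intro u hu
      simpa using hmaps hu
    rw [this]
    exact differentiableOn_empty
  -- Contracting towards `p` moves the curve into `D`, where `f` is holomorphic; uniform continuity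
  -- of `f` lets `r` tend to `1`.
  set σ : ℝ → E → E := fun r z => (1 - r) • p + r • z with hσ
  have hσD : ∀ r ∈ Ioo (0 : ℝ) 1, ∀ z ∈ closure D, σ r z ∈ D := fun r hr z hz => by
    have := hc.combo_interior_closure_mem_interior (ho.interior_eq.symm ▸ hp) hz
      (sub_pos.2 hr.2) hr.1.le (by ring)
    rwa [ho.interior_eq] at this
  have hev : ∀ᶠ r in 𝓝[<] (1 : ℝ), r ∈ Ioo (0 : ℝ) 1 := Ioo_mem_nhdsLT zero_lt_one
  have hlim : TendstoUniformlyOn (fun (r : ℝ) u => f (σ r (φ u))) (f ∘ φ) (𝓝[<] 1) U := by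
    have huc := hb.isCompact_closure.uniformContinuousOn_of_continuous hfc
    rw [Metric.uniformContinuousOn_iff] at huc
    rw [Metric.tendstoUniformlyOn_iff]
    intro ε hε
    obtain ⟨δ, hδ, huc⟩ := huc ε hε
    obtain ⟨M, hM⟩ := hb.closure.subset_closedBall p
    have hsmall : ∀ᶠ r in 𝓝[<] (1 : ℝ), (1 - r) * |M| < δ := by
      have : Tendsto (fun r : ℝ => (1 - r) * |M|) (𝓝 1) (𝓝 ((1 - 1) * |M|)) :=
        Continuous.tendsto (by fun_prop) 1
      rw [sub_self, zero_mul] at this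
      exact (this.mono_left nhdsWithin_le_nhds).eventually (gt_mem_nhds hδ)
    filter_upwards [hev, hsmall] with r hr hrδ u hu
    refine huc _ (hmaps hu) _ (subset_closure (hσD r hr _ (hmaps hu))) (lt_of_le_of_lt ?_ hrδ)
    have h1 : φ u - σ r (φ u) = (1 - r) • (φ u - p) := by
      simp only [hσ]; module
    rw [dist_eq_norm, h1, norm_smul, Real.norm_of_nonneg (sub_nonneg.2 hr.2.le)]
    refine mul_le_mul_of_nonneg_left ?_ (sub_nonneg.2 hr.2.le)
    have := hM (hmaps hu)
    rw [Metric.mem_closedBall, dist_eq_norm] at this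
    exact this.trans (le_abs_self M)
  refine hlim.tendstoLocallyUniformlyOn.differentiableOn ?_ hU
  filter_upwards [hev] with r hr
  refine hfd.comp (t := D) ?_ fun u hu => hσD r hr _ (hmaps hu)
  exact (hφ.const_smul r).const_add _

theorem IsHolomorphicPeakPoint.eq_singleton_of_isAnalyticCurve [ProperSpace E] {D : Set E}
    (ho : IsOpen D) (hc : Convex ℝ D) (hb : Bornology.IsBounded D) {z₀ : E}
    (h : IsHolomorphicPeakPoint D z₀) {C : Set E} (hC : IsAnalyticCurve C)
    (hCD : C ⊆ closure D) (hz₀ : z₀ ∈ C) : C = {z₀} := by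
  obtain ⟨U, φ, hU, hUc, hφ, rfl⟩ := hC
  obtain ⟨f, hfd, hfc, hf1, hf⟩ := h
  obtain ⟨u₀, hu₀, rfl⟩ := hz₀
  have hmaps : MapsTo φ U (closure D) := mapsTo_iff_image_subset.2 hCD
  have hcomp := hc.differentiableOn_comp_of_mapsTo_closure ho hb hfd hfc hU hφ hmaps
  have hmax : IsMaxOn (norm ∘ (f ∘ φ)) U u₀ := by
    intro u hu
    by_cases hne : φ u = φ u₀
    · simp [hne]
    · simpa [hf1] using (hf _ (hmaps hu) hne).le
  have heq := Complex.eqOn_of_isPreconnected_of_isMaxOn_norm hUc.isPreconnected hU hcomp hu₀ hmax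
  refine Subset.antisymm ?_ (singleton_subset_iff.2 ⟨u₀, hu₀, rfl⟩)
  rintro _ ⟨u, hu, rfl⟩
  by_contra hne
  have h1 : f (φ u) = 1 := by simpa [hf1] using heq hu
  simpa [h1] using hf _ (hmaps hu) hne

theorem boundaryDirections_eq_of_forall_isAnalyticCurve {D : Set E} {z₀ : E}
    (hz₀ : z₀ ∈ frontier D)
    (h : ∀ C : Set E, IsAnalyticCurve C → C ⊆ closure D → z₀ ∈ C → C = {z₀}) :
    boundaryDirections D z₀ = {0} := by
  refine Subset.antisymm ?_ (singleton_subset_iff.2 ⟨1, one_pos, fun c _ => by simpa using hz₀⟩)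
  rintro X ⟨ε, hε, hX⟩
  have hC := h ((fun c : ℂ => z₀ + c • X) '' Metric.ball 0 ε)
    ⟨_, _, Metric.isOpen_ball, Metric.isConnected_ball hε, by fun_prop, rfl⟩ ?_
    ⟨0, Metric.mem_ball_self hε, by simp⟩
  · have hm : z₀ + ((ε / 2 : ℝ) : ℂ) • X ∈ (fun c : ℂ => z₀ + c • X) '' Metric.ball 0 ε := by
      refine ⟨((ε / 2 : ℝ) : ℂ), ?_, rfl⟩
      rw [mem_ball_zero_iff, Complex.norm_real, Real.norm_of_nonneg (by positivity)]
      linarith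
    rw [hC, mem_singleton_iff, add_eq_left, smul_eq_zero, Complex.ofReal_eq_zero] at hm
    exact hm.resolve_left (by positivity)
  · rintro _ ⟨c, hc, rfl⟩
    exact frontier_subset_closure (hX c (mem_ball_zero_iff.1 hc).le)

end

theorem theorem6 (n : ℕ) (D : Set (EuclideanSpace ℂ (Fin n)))
    (hD_open : IsOpen D) (hD_convex : Convex ℝ D) (hD_bdd : Bornology.IsBounded D)
    (z₀ : EuclideanSpace ℂ (Fin n)) (hz₀ : z₀ ∈ frontier D) :
    List.TFAE [
      IsHolomorphicPeakPoint D z₀,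
      ∀ C : Set (EuclideanSpace ℂ (Fin n)),
        IsAnalyticCurve C → C ⊆ closure D → z₀ ∈ C → C = {z₀},
      boundaryDirections D z₀ = {0}] := by
  tfae_have 1 → 2 := fun h C hC hCD hz =>
    h.eq_singleton_of_isAnalyticCurve hD_open hD_convex hD_bdd hC hCD hz
  tfae_have 2 → 3 := boundaryDirections_eq_of_forall_isAnalyticCurve hz₀
  tfae_have 3 → 1 := isHolomorphicPeakPoint_of_boundaryDirections hD_open hD_convex hD_bdd hz₀
  tfae_finish
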